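/- Let $(W,S)$ be a finite Coxeter system with length function $\ell$, reflections $\mathcal T=\{xsx^{-1}: x\in W, s\in S\}$ and longest element $w_0$. The Bruhat graph is the directed graph on $W$ with an edge from $x$ to $xt$ whenever $t\in\mathcal T$ and $\ell(xt)>\ell(x)$; these edges generate the Bruhat order, and $[1,w_0]_{\mathcal B}$ denotes the subgraph induced by the Bruhat interval $[1,w_0]$. For $N\ge 1$ and $k_1,\dots,k_N\in\mathbb N$, let $\mathcal C(k_1,\dots,k_N)$ be the directed graph with vertices $\{m\in\mathbb Z^N : 0\le m_i\le k_i \text{ for all } i\}$ and an edge from $u$ to $v$ whenever $v-u$ is a standard basis vector; a cubical lattice is a directed graph isomorphic to one of these. A directed graph is cubulated by a cubical lattice $\mathcal C$ if $\mathcal C$ is isomorphic to one of its spanning subgraphs, and it can be cubulated if it is cubulated by some cubical lattice. Given an ordering $S=\{s_1,\dots,s_n\}$, the normal form of $x\in W$ is its lexicographically first reduced expression. Let $W_{[j]}=\langle s_1,\dots,s_j\rangle$. The normal form forest is $\tau_1,\dots,\tau_n$, where $\tau_j$ is the rooted tree whose vertices are the minimal-length representatives of the right cosets $W_{[j-1]}\backslash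 W_{[j]}$, with root $1$ and an edge labelled $s_i$ from $x$ to $y$ whenever the normal form of $y$ is the normal form of $x$ followed by $s_i$. Theorem. 1. If $(W,S)$ is of type $A_n$ with $n\ge 1$, then $[1,w_0]_{\mathcal B}$ can be cubulated; more precisely, it is cubulated by $\mathcal C(1,2,\dots,n)$. Moreover, $S$ can be ordered so that, for every $j$, the tree $\tau_j$ is a path with $j$ edges. 2. If $(W,S)$ is of type $B_n/C_n$ with $n\ge 2$, then $[1,w_0]_{\mathcal B}$ can be cubulated; more precisely, it is cubulated by $\mathcal C(1,3,\dots,2n-1)$. Moreover, $S$ can be ordered so that, for every $j$, the tree $\tau_j$ is a path with $2j-1$ edges. -/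

import Mathlib

/-! ## Directed graphs, cubical lattices and cubulations

A directed graph with vertex set `V` is a `Digraph V`.  For `D' D : Digraph V`, the relation
`D' ≤ D` says that `D'` is a subgraph of `D` with the same vertex set, i.e. a spanning subgraph. -/

/-- Two directed graphs are isomorphic: there is a bijection of the vertex sets which preserves
and reflects directed edges. -/
def Digraph.IsIsomorphic {U V : Type*} (C : Digraph U) (D : Digraph V) : Prop :=
  Nonempty (C.Adj ≃r D.Adj)

/-- The subgraph of `D` induced by a set `A` of vertices. -/
def Digraph.inducedOn {V : Type*} (D : Digraph V) (A : Set V) : Digraph A where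
  Adj u v := D.Adj u v

/-- The directed path with `l` edges `0 → 1 → ⋯ → l`. -/
def Digraph.directedPath (l : ℕ) : Digraph (Fin (l + 1)) where
  Adj a b := (a : ℕ) + 1 = b

/-- The vertex set of `𝒞(k₁, …, k_N)`: the integer vectors `m` with `0 ≤ mᵢ ≤ kᵢ`. -/
abbrev CubicalVertex {N : ℕ} (k : Fin N → ℕ) : Type :=
  {m : Fin N → ℤ // ∀ i, 0 ≤ m i ∧ m i ≤ (k i : ℤ)}

/-- The directed graph `𝒞(k₁, …, k_N)`: there is an edge from `u` to `v` if and only if `v - u` is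
a standard basis vector. -/
def cubicalLattice {N : ℕ} (k : Fin N → ℕ) : Digraph (CubicalVertex k) where
  Adj u v := ∃ i : Fin N, v.1 - u.1 = Pi.single i (1 : ℤ)

/-- A cubical lattice is a directed graph isomorphic to some `𝒞(k₁, …, k_N)` with `N ≥ 1`. -/
def Digraph.IsCubicalLattice {V : Type*} (D : Digraph V) : Prop :=
  ∃ N : ℕ, 1 ≤ N ∧ ∃ k : Fin N → ℕ, (cubicalLattice k).IsIsomorphic D

/-- `D` is cubulated by `C`: the graph `C` is isomorphic to a spanning subgraph of `D`. -/
def Digraph.IsCubulatedBy {U V : Type*} (D : Digraph V) (C : Digraph U) : Prop :=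
  ∃ D' : Digraph V, D' ≤ D ∧ C.IsIsomorphic D'

/-- `D` can be cubulated: some spanning subgraph of `D` is a cubical lattice. -/
def Digraph.CanBeCubulated {V : Type*} (D : Digraph V) : Prop :=
  ∃ D' : Digraph V, D' ≤ D ∧ D'.IsCubicalLattice

/-! ## Types of Coxeter systems -/

/-- The Coxeter matrix is of type `Aₙ`, for some labelling of the nodes by `Fin n`. -/
def CoxeterMatrix.IsOfTypeA {B : Type*} (M : CoxeterMatrix B) (n : ℕ) : Prop :=
  ∃ e : B ≃ Fin n, M.reindex e = CoxeterMatrix.A n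

/-- The Coxeter matrix is of type `Bₙ`, for some labelling of the nodes by `Fin n`.  Type `Cₙ` has
the same Coxeter matrix, so this is also the meaning of type `Cₙ` for Coxeter systems. -/
def CoxeterMatrix.IsOfTypeB {B : Type*} (M : CoxeterMatrix B) (n : ℕ) : Prop :=
  ∃ e : B ≃ Fin n, M.reindex e = CoxeterMatrix.B n

namespace CoxeterSystem

variable {B W : Type*} [Group W] {M : CoxeterMatrix B} (cs : CoxeterSystem M W)

/-! ## Bruhat graph and Bruhat order -/

/-- `w₀` is an element of maximal length. -/
def IsLongest (w₀ : W) : Prop :=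
  ∀ w : W, cs.length w ≤ cs.length w₀

/-- The Bruhat graph: an edge from `x` to `x t`, for a reflection `t`, whenever
`ℓ(x t) > ℓ(x)`. -/
def bruhatGraph : Digraph W where
  Adj x y := ∃ t : W, cs.IsReflection t ∧ y = x * t ∧ cs.length x < cs.length (x * t)

/-- The Bruhat order, generated by the edges of the Bruhat graph. -/
def BruhatLE (x y : W) : Prop :=
  Relation.ReflTransGen cs.bruhatGraph.Adj x y

/-- The interval `[x, y]` in Bruhat order. -/
def bruhatInterval (x y : W) : Set W :=
  {z | cs.BruhatLE x z ∧ cs.BruhatLE z y}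

/-- The subgraph of the Bruhat graph induced by the interval `[x, y]`. -/
def bruhatIntervalGraph (x y : W) : Digraph (cs.bruhatInterval x y) :=
  cs.bruhatGraph.inducedOn (cs.bruhatInterval x y)

/-! ## Normal form forest

The simple reflections are listed as `s_{e 0}, …, s_{e (n - 1)}` by a bijection `e : Fin n ≃ B`.
Words are lists of indices in `Fin n`, compared lexicographically. -/

/-- The standard parabolic subgroup generated by the simple reflections indexed by `J`. -/
def standardParabolic (J : Set B) : Subgroup W :=
  Subgroup.closure (cs.simple '' J)

variable {n : ℕ} (e : Fin n ≃ B)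

/-- The word `ω` is a reduced expression for `x`. -/
def IsReducedExpression (x : W) (ω : List (Fin n)) : Prop :=
  cs.IsReduced (ω.map e) ∧ cs.wordProd (ω.map e) = x

/-- The word `ω` is the normal form of `x`: its lexicographically first reduced expression. -/
def IsNormalForm (x : W) (ω : List (Fin n)) : Prop :=
  cs.IsReducedExpression e x ω ∧
    ∀ ω' : List (Fin n), cs.IsReducedExpression e x ω' → ω ≤ ω'

/-- The minimal-length representatives of the right cosets `W_{<j} \ W_{≤j}`, where `W_{<j}` and
`W_{≤j}` are generated by the simple reflections listed strictly before `j`, respectively up to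
and including `j`. -/
def minCosetReps (j : Fin n) : Set W :=
  {x | x ∈ cs.standardParabolic (e '' Set.Iic j) ∧
    ∀ u ∈ cs.standardParabolic (e '' Set.Iio j), cs.length x ≤ cs.length (u * x)}

/-- The `j`-th tree of the normal form forest, with edges directed away from the root `1`.  Its
vertices are the minimal-length coset representatives; there is an edge labelled `i` from `x` to
`y` if and only if the normal form of `y` is the normal form of `x` followed by the letter `i`. -/
def normalFormTree (j : Fin n) : Digraph (cs.minCosetReps e j) where
  Adj x y := ∃ (ω : List (Fin n)) (i : Fin n),
    cs.IsNormalForm e (x : W) ω ∧ cs.IsNormalForm e (y : W) (ω ++ [i])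

end CoxeterSystem

/-!
Types `A` and `B` are treated together.  Number the nodes along the Coxeter diagram, in type `B`
starting at the end with the bond of label `4`.  For every `j` consider the path of group elements
`1, s_j, s_j s_{j-1}, …` given by the prefixes of the word `s_j ⋯ s_0` in type `A` and of
`s_j ⋯ s_1 s_0 s_1 ⋯ s_j` in type `B`; in both cases the `k`-th letter is `s_{|j - k|}`.  To an
integer vector `f` in the box belongs the product of the elements number `f j` of the `j`-th path,
`j = 0, …, n - 1` (`latticeProd`).  Everything follows from two facts: every element of `W` is such
a product for exactly one `f`, and its length is the sum of the `f j`.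

* Existence (`BraidRelations.exists_latticeProd_mul`).  By the braid relations, multiplying an
  element of the `j`-th path on the right by `s_i`, `i ≤ j`, either moves it along an edge of the
  path or equals multiplying it on the left by some `s_{i'}` with `i' < j`
  (`BraidRelations.pathProd_mul_cases`).  So the products are closed under right multiplication by
  generators, and the same holds in the parabolic subgroups on the first few nodes.
* Uniqueness and length (`CoxeterSystem.length_latticeProd`, `CoxeterSystem.latticeProd_injective`).
  The rule above, read as a definition, lets the generators act on integer vectors, one coordinate
  after another.  These maps satisfy the Coxeter relations (`LatticePoint.braidRelations_act`), so
  `W` acts.  Applied to the zero vector, the product belonging to `f` gives back `f`.  As a generator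
  raises the sum of the coordinates by at most one, that sum is a lower bound for the length.

Raising one coordinate of `f` by one multiplies the product on the right by a conjugate of a
generator and raises the length, so the edges of the cubical lattice are edges of the Bruhat graph.
The longest element belongs to the largest vector, hence the interval `[1, w₀]` is all of `W`.
Finally, by the length formula the element number `k` of the `j`-th path has only one right
descent, hence only one reduced word, which is then its normal form; and the minimal coset
representatives are the products with a single nonzero coordinate `f j`.
-/

/-! ### Paths, labels and braid relations -/

/-- The number of edges of the `j`-th path (`j = 0, 1, …`): `j + 1` in type `A` (`b = false`) and
`2 j + 1` in type `B` (`b = true`). -/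
def pathLength (b : Bool) (j : ℕ) : ℕ := if b then 2 * j + 1 else j + 1

/-- The label `|j - k|` of the edge from `k` to `k + 1` in the `j`-th path. -/
def pathLabel (j k : ℕ) : ℕ := if k ≤ j then j - k else k - j

/-- The elements `s 0, …, s (n - 1)` of a monoid satisfy the Coxeter relations of type `A`
(`b = false`) or `B` (`b = true`), in braid form.  The nodes are numbered along the diagram, and in
type `B` the bond of label `4` joins the nodes `0` and `1`. -/
structure BraidRelations (b : Bool) (n : ℕ) {G : Type*} [Monoid G] (s : ℕ → G) : Prop where
  sq : ∀ i < n, s i * s i = 1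
  comm : ∀ i j, i + 2 ≤ j → j < n → s i * s j = s j * s i
  braid : ∀ i, i + 1 < n → (b = true → i ≠ 0) →
    s i * s (i + 1) * s i = s (i + 1) * s i * s (i + 1)
  braid_four : b = true → 1 < n → s 0 * s 1 * s 0 * s 1 = s 1 * s 0 * s 1 * s 0

/-- The braid relations for self-maps of a set, evaluated pointwise. -/
theorem braidRelations_end_iff {b : Bool} {n : ℕ} {Y : Type*} {a : ℕ → Y → Y} :
    BraidRelations b n (G := Function.End Y) a ↔
      (∀ i < n, ∀ y, a i (a i y) = y) ∧
      (∀ i j, i + 2 ≤ j → j < n → ∀ y, a i (a j y) = a j (a i y)) ∧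
      (∀ i, i + 1 < n → (b = true → i ≠ 0) → ∀ y,
        a i (a (i + 1) (a i y)) = a (i + 1) (a i (a (i + 1) y))) ∧
      (b = true → 1 < n → ∀ y, a 0 (a 1 (a 0 (a 1 y))) = a 1 (a 0 (a 1 (a 0 y)))) :=
  ⟨fun h => ⟨fun i hi => congrFun (h.sq i hi), fun i j hij hj => congrFun (h.comm i j hij hj),
    fun i hi hb => congrFun (h.braid i hi hb), fun hb hn => congrFun (h.braid_four hb hn)⟩,
  fun ⟨h1, h2, h3, h4⟩ => ⟨fun i hi => funext (h1 i hi), fun i j hij hj => funext (h2 i j hij hj),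
    fun i hi hb => funext (h3 i hi hb), fun hb hn => funext (h4 hb hn)⟩⟩

/-! ### The induced action on lattice points -/

/-- The step of the induction that lets the generators act on lattice points.  Given self-maps
`a i` of `Y` (`i < N`), the generator `i ≤ N` sends `(y, k)` to `(y, k ± 1)` if it labels an edge of
the `N`-th path at `k`, and otherwise applies `a i` or `a (i - 1)` to `y`.  This mirrors the action
of the larger group on the cosets of the smaller one.  The pairs with `k > pathLength b N`, which
lie outside the box, are fixed, so that the relations hold on all of `Y × ℕ`. -/
def inducedAction (b : Bool) (N : ℕ) {Y : Type*} (a : ℕ → Y → Y) (i : ℕ) (x : Y × ℕ) :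
    Y × ℕ :=
  if pathLength b N < x.2 then x
  else if x.2 ≤ N then
    if i + x.2 < N then (a i x.1, x.2)
    else if i + x.2 = N then (x.1, x.2 + 1)
    else if i + x.2 = N + 1 then (x.1, x.2 - 1)
    else (a (i - 1) x.1, x.2)
  else
    if i + N + 1 < x.2 then (a i x.1, x.2)
    else if i + N + 1 = x.2 then (x.1, x.2 - 1)
    else if b ∧ i + N = x.2 then (x.1, x.2 + 1)
    else (a (i - 1) x.1, x.2)

theorem inducedAction_fix {b : Bool} {N : ℕ} {Y : Type*} {a : ℕ → Y → Y} {i k : ℕ} {y : Y}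
    (h : pathLength b N < k) : inducedAction b N a i (y, k) = (y, k) := by
  simp [inducedAction, h]

section TypeA

variable {N : ℕ} {Y : Type*} {a : ℕ → Y → Y} {i k : ℕ} {y : Y}

theorem inducedAction_false_push (h : i + k < N) :
    inducedAction false N a i (y, k) = (a i y, k) := by
  unfold inducedAction pathLength; grind

theorem inducedAction_false_up (h : i + k = N) :
    inducedAction false N a i (y, k) = (y, k + 1) := by
  unfold inducedAction pathLength; grind

theorem inducedAction_false_down (h : i ≤ N ∧ i + k = N + 1) :
    inducedAction false N a i (y, k) = (y, k - 1) := by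
  unfold inducedAction pathLength; grind

theorem inducedAction_false_sub (h : k ≤ N + 1 ∧ N + 1 < i + k) :
    inducedAction false N a i (y, k) = (a (i - 1) y, k) := by
  unfold inducedAction pathLength; grind

/-- In each of the possible positions of the generators relative to the vertex `k`, the two sides of
a relation walk to the same end on the path, and the maps that they apply to the first component
agree by a relation of `a`. -/
theorem BraidRelations.inducedAction_false (h : BraidRelations false N (G := Function.End Y) a) :
    BraidRelations false (N + 1) (G := Function.End (Y × ℕ)) (inducedAction false N a) := by
  obtain ⟨h1, h2, h3, -⟩ := braidRelations_end_iff.1 h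
  rw [braidRelations_end_iff]
  refine ⟨fun i hi ⟨y, k⟩ => ?_, fun i j hij hj ⟨y, k⟩ => ?_, fun i hi _ ⟨y, k⟩ => ?_,
    fun hb => by simp at hb⟩
  all_goals
    rcases lt_or_ge (pathLength false N) k with hk | hk
    · simp [inducedAction_fix hk]
    replace hk : k ≤ N + 1 := hk
  · obtain c | c | c | c : i + k < N ∨ i + k = N ∨ i + k = N + 1 ∨ N + 1 < i + k := by omega
    all_goals simp (disch := omega) only [inducedAction_false_push, inducedAction_false_up,
      inducedAction_false_down, inducedAction_false_sub]
    all_goals grind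
  · obtain c | c | c | c : i + k < N ∨ i + k = N ∨ i + k = N + 1 ∨ N + 1 < i + k := by omega
    all_goals
      obtain d | d | d | d : j + k < N ∨ j + k = N ∨ j + k = N + 1 ∨ N + 1 < j + k := by omega
    all_goals first
      | omega
      | simp (disch := omega) only [inducedAction_false_push, inducedAction_false_up,
          inducedAction_false_down, inducedAction_false_sub]
    all_goals grind
  · obtain c | c | c | c | c : i + k + 1 < N ∨ i + k + 1 = N ∨ i + k = N ∨ i + k = N + 1 ∨
        N + 1 < i + k := by omega
    all_goals simp (disch := omega) only [inducedAction_false_push, inducedAction_false_up,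
      inducedAction_false_down, inducedAction_false_sub]
    all_goals grind

end TypeA

section TypeB

variable {N : ℕ} {Y : Type*} {a : ℕ → Y → Y} {i k : ℕ} {y : Y}

theorem inducedAction_true_push (h : i + k < N ∨ i + N + 1 < k ∧ k ≤ 2 * N + 1) :
    inducedAction true N a i (y, k) = (a i y, k) := by
  unfold inducedAction pathLength; grind

theorem inducedAction_true_up (h : i + k = N ∨ i + N = k ∧ i ≤ N) :
    inducedAction true N a i (y, k) = (y, k + 1) := by
  unfold inducedAction pathLength; grind

theorem inducedAction_true_down (h : i ≤ N ∧ i + k = N + 1 ∨ i + N + 1 = k ∧ i ≤ N) :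
    inducedAction true N a i (y, k) = (y, k - 1) := by
  unfold inducedAction pathLength; grind

theorem inducedAction_true_sub (h : k ≤ 2 * N + 1 ∧ N + 1 < i + k ∧ k < i + N) :
    inducedAction true N a i (y, k) = (a (i - 1) y, k) := by
  unfold inducedAction pathLength; grind

theorem BraidRelations.inducedAction_true (h : BraidRelations true N (G := Function.End Y) a) :
    BraidRelations true (N + 1) (G := Function.End (Y × ℕ)) (inducedAction true N a) := by
  obtain ⟨h1, h2, h3, h4⟩ := braidRelations_end_iff.1 h
  rw [braidRelations_end_iff]
  refine ⟨fun i hi ⟨y, k⟩ => ?_, fun i j hij hj ⟨y, k⟩ => ?_, fun i hi hi0 ⟨y, k⟩ => ?_,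
    fun _ hN ⟨y, k⟩ => ?_⟩
  all_goals
    rcases lt_or_ge (pathLength true N) k with hk | hk
    · simp [inducedAction_fix hk]
    replace hk : k ≤ 2 * N + 1 := hk
  · obtain c | c | c | c :
        (i + k < N ∨ i + N + 1 < k ∧ k ≤ 2 * N + 1) ∨ (i + k = N ∨ i + N = k ∧ i ≤ N) ∨
        (i ≤ N ∧ i + k = N + 1 ∨ i + N + 1 = k ∧ i ≤ N) ∨ (N + 1 < i + k ∧ k < i + N) := by omega
    all_goals simp (disch := omega) only [inducedAction_true_push, inducedAction_true_up,
      inducedAction_true_down, inducedAction_true_sub]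
    all_goals grind
  · obtain c | c | c | c :
        (i + k < N ∨ i + N + 1 < k ∧ k ≤ 2 * N + 1) ∨ (i + k = N ∨ i + N = k ∧ i ≤ N) ∨
        (i ≤ N ∧ i + k = N + 1 ∨ i + N + 1 = k ∧ i ≤ N) ∨ (N + 1 < i + k ∧ k < i + N) := by omega
    all_goals obtain d | d | d | d :
        (j + k < N ∨ j + N + 1 < k ∧ k ≤ 2 * N + 1) ∨ (j + k = N ∨ j + N = k ∧ j ≤ N) ∨
        (j ≤ N ∧ j + k = N + 1 ∨ j + N + 1 = k ∧ j ≤ N) ∨ (N + 1 < j + k ∧ k < j + N) := by omega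
    all_goals first
      | omega
      | simp (disch := omega) only [inducedAction_true_push, inducedAction_true_up,
          inducedAction_true_down, inducedAction_true_sub]
    all_goals grind
  · have hi0 := hi0 rfl
    obtain c | c | c | c | c | c | c | c | c :
        i + k + 1 < N ∨ i + k + 1 = N ∨ i + k = N ∨ i + k = N + 1 ∨ (N + 1 < i + k ∧ k < i + N) ∨
        k = i + N ∨ k = i + N + 1 ∨ k = i + N + 2 ∨ i + N + 2 < k := by omega
    all_goals simp (disch := omega) only [inducedAction_true_push, inducedAction_true_up,
      inducedAction_true_down, inducedAction_true_sub]
    all_goals grind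
  · obtain c | c | c | c | c | c :
        k + 1 < N ∨ k + 1 = N ∨ k = N ∨ k = N + 1 ∨ k = N + 2 ∨ N + 2 < k := by omega
    all_goals simp (disch := omega) only [inducedAction_true_push, inducedAction_true_up,
      inducedAction_true_down]
    all_goals first | rw [h4 rfl (by omega)] | grind

end TypeB

theorem BraidRelations.inducedAction {b : Bool} {N : ℕ} {Y : Type*} {a : ℕ → Y → Y}
    (h : BraidRelations b N (G := Function.End Y) a) :
    BraidRelations b (N + 1) (G := Function.End (Y × ℕ)) (inducedAction b N a) := by
  cases b
  exacts [h.inducedAction_false, h.inducedAction_true]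

theorem pathLabel_lt {b : Bool} {j k n : ℕ} (hj : j < n) (hk : k < pathLength b j) :
    pathLabel j k < n := by
  unfold pathLabel pathLength at *; grind

/-- The vectors of `N` natural numbers, as nested pairs. -/
def LatticePoint : ℕ → Type
  | 0 => Unit
  | N + 1 => LatticePoint N × ℕ

namespace LatticePoint

/-- The vector `(f 0, …, f (N - 1))`. -/
def ofFun : (N : ℕ) → (ℕ → ℕ) → LatticePoint N
  | 0, _ => ()
  | N + 1, f => (ofFun N f, f N)

/-- The sum of the coordinates. -/
def size : {N : ℕ} → LatticePoint N → ℕ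
  | 0, _ => 0
  | _ + 1, x => size x.1 + x.2

/-- The self-map of lattice points induced by the `i`-th generator. -/
def act (b : Bool) : (N : ℕ) → ℕ → LatticePoint N → LatticePoint N
  | 0, _ => id
  | N + 1, i => inducedAction b N (act b N) i

theorem braidRelations_act (b : Bool) :
    ∀ N, BraidRelations b N (G := Function.End (LatticePoint N)) (act b N)
  | 0 => ⟨by simp, by simp, by simp, by simp⟩
  | N + 1 => (braidRelations_act b N).inducedAction

theorem size_act_le (b : Bool) : ∀ (N i : ℕ) (x : LatticePoint N), (act b N i x).size ≤ x.size + 1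
  | 0, _, _ => Nat.zero_le _
  | N + 1, i, (y, k) => by
    have h1 := size_act_le b N i y
    have h2 := size_act_le b N (i - 1) y
    change size (N := N + 1) (inducedAction b N (act b N) i (y, k)) ≤ _
    unfold inducedAction
    simp only [size]
    grind

theorem size_ofFun (f : ℕ → ℕ) : ∀ N, (ofFun N f).size = ∑ j ∈ Finset.range N, f j
  | 0 => rfl
  | N + 1 => by rw [Finset.sum_range_succ, ← size_ofFun f N]; rfl

theorem ofFun_congr {f g : ℕ → ℕ} : ∀ {N : ℕ}, (∀ j < N, f j = g j) → ofFun N f = ofFun N g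
  | 0, _ => rfl
  | N + 1, h => Prod.ext (ofFun_congr fun j hj => h j (by omega)) (h N (by omega))

theorem eq_of_ofFun_eq {f g : ℕ → ℕ} : ∀ {N : ℕ}, ofFun N f = ofFun N g → ∀ j < N, f j = g j
  | N + 1, h, j, hj => by
    obtain ⟨h1, h2⟩ := Prod.ext_iff.1 h
    rcases Nat.lt_succ_iff_lt_or_eq.1 hj with hj | rfl
    exacts [eq_of_ofFun_eq h1 j hj, h2]

/-- The label of the edge from `k` to `k + 1` of the `j`-th path moves the coordinate `j` along this
edge, provided that the later coordinates vanish. -/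
theorem act_pathLabel {b : Bool} {j k : ℕ} {f : ℕ → ℕ} (hk : k < pathLength b j) (hf : f j = k)
    (h0 : ∀ i, j < i → f i = 0) : ∀ {N : ℕ}, j < N →
      act b N (pathLabel j k) (ofFun N f) = ofFun N (Function.update f j (k + 1))
  | N + 1, hj => by
    change inducedAction b N (act b N) (pathLabel j k) (ofFun N f, f N) =
      (ofFun N (Function.update f j (k + 1)), Function.update f j (k + 1) N)
    have hl : pathLabel j k ≤ j := by unfold pathLabel pathLength at *; grind
    rcases Nat.lt_succ_iff_lt_or_eq.1 hj with hj | rfl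
    · rw [← act_pathLabel (b := b) hk hf h0 hj, Function.update_of_ne hj.ne', h0 N hj]
      unfold inducedAction; grind
    · have hu : ofFun j (Function.update f j (k + 1)) = ofFun j f :=
        ofFun_congr fun i hi => Function.update_of_ne hi.ne _ _
      rw [Function.update_self, hf, hu]
      unfold inducedAction pathLabel pathLength at *; grind

end LatticePoint

/-! ### Products along the paths -/

section PathProd

variable {G : Type*} [Monoid G]

/-- The product of the labels of the first `k` edges of the `j`-th path. -/
def pathProd (s : ℕ → G) (j : ℕ) : ℕ → G
  | 0 => 1
  | k + 1 => pathProd s j k * s (pathLabel j k)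

theorem pathProd_one (s : ℕ → G) (j : ℕ) : pathProd s j 1 = s j := by
  simp [pathProd, pathLabel]

/-- The product over `j = 0, …, N - 1`, in this order, of the element number `f j` of the `j`-th
path. -/
def latticeProd (s : ℕ → G) : (N : ℕ) → (ℕ → ℕ) → G
  | 0, _ => 1
  | N + 1, f => latticeProd s N f * pathProd s N (f N)

theorem latticeProd_congr {s : ℕ → G} {f g : ℕ → ℕ} :
    ∀ {N : ℕ}, (∀ j < N, f j = g j) → latticeProd s N f = latticeProd s N g
  | 0, _ => rfl
  | N + 1, h => by
    rw [latticeProd, latticeProd, latticeProd_congr fun j hj => h j (by omega), h N (by omega)]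

theorem latticeProd_zero {s : ℕ → G} : ∀ {N : ℕ}, latticeProd s N 0 = 1
  | 0 => rfl
  | N + 1 => by simp [latticeProd, latticeProd_zero (N := N), pathProd]

theorem latticeProd_single {s : ℕ → G} {j k : ℕ} :
    ∀ {N : ℕ}, j < N → latticeProd s N (Pi.single j k) = pathProd s j k
  | N + 1, hj => by
    rcases Nat.lt_succ_iff_lt_or_eq.1 hj with hj | rfl
    · rw [latticeProd, latticeProd_single hj, Pi.single_eq_of_ne hj.ne', pathProd, mul_one]
    · rw [latticeProd, Pi.single_eq_same,
        latticeProd_congr (g := 0) fun i hi => Pi.single_eq_of_ne hi.ne _, latticeProd_zero, one_mul]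

theorem latticeProd_update {s : ℕ → G} {f : ℕ → ℕ} {N k : ℕ} :
    latticeProd s (N + 1) (Function.update f N k) = latticeProd s N f * pathProd s N k := by
  rw [latticeProd, Function.update_self,
    latticeProd_congr fun j hj => Function.update_of_ne (by omega) _ _]

namespace BraidRelations

variable {b : Bool} {n : ℕ} {s : ℕ → G} (h : BraidRelations b n s)
include h

/-- The letters before the position `k` are all at least `i + 2`. -/
theorem pathProd_mul_of_lt {j k i : ℕ} (hj : j < n) (hk : i + k < j) :
    pathProd s j k * s i = s i * pathProd s j k := by
  induction k with
  | zero => simp [pathProd]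
  | succ k ih =>
    have : i + 2 ≤ pathLabel j k ∧ pathLabel j k < n := by unfold pathLabel; grind
    rw [pathProd, mul_assoc, ← h.comm i _ this.1 this.2, ← mul_assoc, ih (by omega), mul_assoc]

/-- Here `s (i + 1)` moves left up to the letters `i + 1, i` on the way down to `0`, where the
braid relation turns it into `s i`. -/
theorem pathProd_mul_succ {j k i : ℕ} (hj : j < n) (hi : i < j) (hik : j < i + k)
    (hk : k ≤ i + j ∨ b = false ∧ k ≤ j + 1) :
    pathProd s j k * s (i + 1) = s i * pathProd s j k := by
  induction k with
  | zero => omega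
  | succ k ih =>
    rcases Nat.lt_or_ge j (i + k) with hik' | hik'
    · have : pathLabel j k + 2 ≤ i + 1 := by unfold pathLabel; grind
      rw [pathProd, mul_assoc, h.comm _ _ this (by omega), ← mul_assoc,
        ih hik' (by omega), mul_assoc]
    · obtain ⟨k, rfl⟩ : ∃ k', k = k' + 1 := ⟨k - 1, by omega⟩
      have hl' : pathLabel j k = i + 1 := by unfold pathLabel; grind
      have hl : pathLabel j (k + 1) = i := by unfold pathLabel; grind
      have hb : b = true → i ≠ 0 := by rintro rfl; grind
      simp only [pathProd, hl, hl']
      rw [mul_assoc, mul_assoc, ← mul_assoc (s (i + 1)), ← h.braid i (by omega) hb, mul_assoc,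
        ← mul_assoc, h.pathProd_mul_of_lt hj (by omega), mul_assoc, mul_assoc]

/-- Here `s i` moves left up to the letters `i, i + 1` on the way up from `0`, where the braid
relation turns it into `s (i + 1)`, and `pathProd_mul_succ` turns that back into `s i`.  For `i = 0`
it is the relation of length four that applies, to the letters `1, 0, 1`. -/
theorem pathProd_mul_of_gt {j k i : ℕ} (hb : b = true) (hj : j < n) (hik : i + j + 1 < k)
    (hk : k ≤ 2 * j + 1) : pathProd s j k * s i = s i * pathProd s j k := by
  induction k with
  | zero => omega
  | succ k ih =>
    rcases Nat.lt_or_ge (i + j + 1) k with hik' | hik'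
    · have : i + 2 ≤ pathLabel j k ∧ pathLabel j k < n := by unfold pathLabel; grind
      rw [pathProd, mul_assoc, ← h.comm _ _ this.1 this.2, ← mul_assoc,
        ih hik' (by omega), mul_assoc]
    · obtain rfl : k = i + j + 1 := by omega
      have hl' : pathLabel j (i + j) = i := by unfold pathLabel; grind
      have hl : pathLabel j (i + j + 1) = i + 1 := by unfold pathLabel; grind
      rcases Nat.eq_zero_or_pos i with rfl | hi
      · obtain ⟨j, rfl⟩ : ∃ j', j = j' + 1 := ⟨j - 1, by omega⟩
        have hl'' : pathLabel (j + 1) j = 1 := by unfold pathLabel; grind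
        simp only [zero_add] at hl hl' ⊢
        simp only [pathProd, hl, hl', hl'']
        have h4 := h.braid_four hb (by omega)
        simp only [mul_assoc] at h4 ⊢
        rw [← h4, ← mul_assoc, h.pathProd_mul_of_lt hj (by omega), mul_assoc]
      · simp only [pathProd, hl, hl']
        have h3 := h.braid i (by omega) (by omega)
        have h5 := h.pathProd_mul_succ (k := i + j) (i := i) hj (by omega) (by omega) (by omega)
        simp only [mul_assoc] at h3 ⊢
        rw [h3, ← mul_assoc, h5, mul_assoc]

/-- A generator multiplied to the right of an element of the `j`-th path either moves along an
edge of the path or is turned into a generator `s i'` with `i' < j` on the left. -/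
theorem pathProd_mul_cases {j k i : ℕ} (hj : j < n) (hi : i ≤ j) (hk : k ≤ pathLength b j) :
    (i = pathLabel j k ∧ k < pathLength b j) ∨ (∃ k', k = k' + 1 ∧ i = pathLabel j k') ∨
      ∃ i' < j, pathProd s j k * s i = s i' * pathProd s j k := by
  by_cases c1 : i + k < j
  · exact .inr (.inr ⟨i, by omega, h.pathProd_mul_of_lt hj c1⟩)
  by_cases c2 : i + k = j
  · left; unfold pathLabel pathLength; grind
  by_cases c3 : i + k = j + 1
  · exact .inr (.inl ⟨k - 1, by unfold pathLabel; grind⟩)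
  cases b with
  | false =>
    obtain ⟨i, rfl⟩ : ∃ i', i = i' + 1 := ⟨i - 1, by unfold pathLength at hk; grind⟩
    exact .inr (.inr ⟨i, by omega, h.pathProd_mul_succ hj (by omega) (by omega) (.inr ⟨rfl, hk⟩)⟩)
  | true =>
    replace hk : k ≤ 2 * j + 1 := hk
    by_cases c4 : i + j + 1 < k
    · exact .inr (.inr ⟨i, by omega, h.pathProd_mul_of_gt rfl hj c4 hk⟩)
    by_cases c5 : i + j + 1 = k
    · exact .inr (.inl ⟨k - 1, by unfold pathLabel; grind⟩)
    by_cases c6 : i + j = k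
    · left; unfold pathLabel pathLength; grind
    obtain ⟨i, rfl⟩ : ∃ i', i = i' + 1 := ⟨i - 1, by omega⟩
    exact .inr (.inr ⟨i, by omega, h.pathProd_mul_succ hj (by omega) (by omega) (by omega)⟩)

theorem pathProd_succ_mul_pathLabel {j k : ℕ} (hj : j < n) (hk : k < pathLength b j) :
    pathProd s j (k + 1) * s (pathLabel j k) = pathProd s j k := by
  rw [pathProd, mul_assoc, h.sq _ (pathLabel_lt hj hk), mul_one]

/-- The products belonging to the vectors in the box are closed under right multiplication by
generators. -/
theorem exists_latticeProd_mul : ∀ {N : ℕ}, N ≤ n → ∀ {i : ℕ}, i < N → ∀ {f : ℕ → ℕ},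
    (∀ j, f j ≤ pathLength b j) →
    ∃ g : ℕ → ℕ, (∀ j, g j ≤ pathLength b j) ∧ latticeProd s N f * s i = latticeProd s N g
  | N + 1, hN, i, hi, f, hf => by
    rcases h.pathProd_mul_cases (j := N) (i := i) (by omega) (by omega) (hf N) with
      ⟨rfl, hk⟩ | ⟨k, hk, rfl⟩ | ⟨i', hi', hp⟩
    · refine ⟨Function.update f N (f N + 1), fun j => ?_, ?_⟩
      · by_cases hj : j = N <;> simp_all
      · rw [latticeProd_update, latticeProd, pathProd, mul_assoc]
    · have := hf N
      refine ⟨Function.update f N k, fun j => ?_, ?_⟩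
      · by_cases hj : j = N
        · subst hj; rw [Function.update_self]; omega
        · simp [hj, hf]
      · rw [latticeProd_update, latticeProd, mul_assoc, hk,
          h.pathProd_succ_mul_pathLabel (by omega) (by omega)]
    · obtain ⟨g, hg, hfg⟩ := exists_latticeProd_mul (by omega : N ≤ n) hi' hf
      refine ⟨Function.update g N (f N), fun j => ?_, ?_⟩
      · by_cases hj : j = N
        · subst hj; simp [hf]
        · simp [hj, hg]
      · rw [latticeProd_update, latticeProd, mul_assoc, hp, ← mul_assoc, hfg]

end BraidRelations

end PathProd

/-- Raising one coordinate by one multiplies the product on the right by a conjugate of a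
generator. -/
theorem exists_latticeProd_update_succ {G : Type*} [Group G] {s : ℕ → G} {f : ℕ → ℕ} {j : ℕ} :
    ∀ {N : ℕ}, j < N → ∃ u : G, latticeProd s N (Function.update f j (f j + 1)) =
      latticeProd s N f * (u * s (pathLabel j (f j)) * u⁻¹)
  | N + 1, hj => by
    rcases Nat.lt_succ_iff_lt_or_eq.1 hj with hj | rfl
    · obtain ⟨u, hu⟩ := exists_latticeProd_update_succ (s := s) (f := f) hj
      refine ⟨(pathProd s N (f N))⁻¹ * u, ?_⟩
      rw [latticeProd, hu, Function.update_of_ne hj.ne', latticeProd]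
      group
    · exact ⟨1, by rw [latticeProd_update, latticeProd, pathProd]; group⟩

/-! ### Braid form and power form of the Coxeter relations -/

section Involutions

variable {G : Type*} [Monoid G] {x y : G}

theorem mul_pow_two_of_comm (hx : x * x = 1) (hy : y * y = 1) (h : x * y = y * x) :
    (x * y) ^ 2 = 1 := by
  rw [pow_two]; nth_rw 2 [h]
  rw [mul_assoc, ← mul_assoc y, hy, one_mul, hx]

theorem mul_pow_three_of_braid (hx : x * x = 1) (hy : y * y = 1)
    (h : x * y * x = y * x * y) : (x * y) ^ 3 = 1 := by
  calc (x * y) ^ 3 = (x * y * x) * (y * x * y) := by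
        simp only [pow_succ, pow_zero, one_mul, mul_assoc]
    _ = y * x * (y * y) * x * y := by rw [h]; simp only [mul_assoc]
    _ = 1 := by rw [hy, mul_one, mul_assoc y, hx, mul_one, hy]

theorem mul_pow_four_of_braid (hx : x * x = 1) (hy : y * y = 1)
    (h : x * y * x * y = y * x * y * x) : (x * y) ^ 4 = 1 := by
  calc (x * y) ^ 4 = (x * y * x * y) * (x * y * x * y) := by
        simp only [pow_succ, pow_zero, one_mul, mul_assoc]
    _ = y * x * y * (x * x) * y * x * y := by nth_rw 1 [h]; simp only [mul_assoc]
    _ = 1 := by rw [hx, mul_one, mul_assoc (y * x), hy, mul_one, mul_assoc y, hx, mul_one, hy]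

end Involutions

/-- The entries of the Coxeter matrix of type `A` (`b = false`) or `B` (`b = true`), where in type
`B` the nodes `0` and `1` are joined by the bond of label `4`. -/
def bondLabel (b : Bool) (i j : ℕ) : ℕ :=
  if i = j then 1 else if i + 1 = j ∨ j + 1 = i then if b ∧ (i = 0 ∨ j = 0) then 4 else 3 else 2

theorem BraidRelations.mul_pow_bondLabel {b : Bool} {n : ℕ} {G : Type*} [Monoid G] {s : ℕ → G}
    (h : BraidRelations b n s) {i j : ℕ} (hi : i < n) (hj : j < n) :
    (s i * s j) ^ bondLabel b i j = 1 := by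
  have hi2 := h.sq i hi
  have hj2 := h.sq j hj
  unfold bondLabel
  split_ifs with c1 c2 c3
  · subst c1; rw [pow_one, hi2]
  · have hc := h.braid_four c3.1 (by omega)
    rcases c2 with rfl | rfl
    · obtain rfl : i = 0 := by omega
      exact mul_pow_four_of_braid hi2 hj2 hc
    · obtain rfl : j = 0 := by omega
      exact mul_pow_four_of_braid hi2 hj2 hc.symm
  · rcases c2 with rfl | rfl
    · exact mul_pow_three_of_braid hi2 hj2 (h.braid i hj (by tauto))
    · exact mul_pow_three_of_braid hi2 hj2 (h.braid j hi (by tauto)).symm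
  · rcases Nat.lt_or_gt_of_ne c1 with c | c
    · exact mul_pow_two_of_comm hi2 hj2 (h.comm i j (by omega) hj)
    · exact mul_pow_two_of_comm hi2 hj2 (h.comm j i (by omega) hi).symm

theorem braidRelations_of_pow {b : Bool} {n : ℕ} {G : Type*} [Group G] {s : ℕ → G}
    (h : ∀ i < n, ∀ j < n, (s i * s j) ^ bondLabel b i j = 1) : BraidRelations b n s := by
  have sq : ∀ i < n, s i * s i = 1 := fun i hi => by simpa [bondLabel] using h i hi i hi
  have inv : ∀ i < n, (s i)⁻¹ = s i := fun i hi => inv_eq_of_mul_eq_one_left (sq i hi)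
  refine ⟨sq, fun i j hij hj => ?_, fun i hi hb => ?_, fun hb hn => ?_⟩
  · have e : bondLabel b i j = 2 := by unfold bondLabel; grind
    have := h i (by omega) j hj
    rw [e, pow_two] at this
    simpa [inv _ hj, inv i (by omega)] using eq_inv_of_mul_eq_one_left this
  · have e : bondLabel b i (i + 1) = 3 := by unfold bondLabel; grind
    have := h i (by omega) (i + 1) hi
    rw [e] at this
    replace this : (s i * s (i + 1) * s i) * (s (i + 1) * s i * s (i + 1)) = 1 := by
      rw [← this]; simp only [pow_succ, pow_zero, one_mul, mul_assoc]
    simpa [inv _ hi, inv i (by omega), mul_assoc] using eq_inv_of_mul_eq_one_left this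
  · have e : bondLabel b 0 1 = 4 := by simp [bondLabel, hb]
    have := h 0 (by omega) 1 hn
    rw [e] at this
    replace this : (s 0 * s 1 * s 0 * s 1) * (s 0 * s 1 * s 0 * s 1) = 1 := by
      rw [← this]; simp only [pow_succ, pow_zero, one_mul, mul_assoc]
    simpa [inv 1 hn, inv 0 (by omega), mul_assoc] using eq_inv_of_mul_eq_one_left this

/-- The numbering `e` of the simple reflections runs along a diagram of type `A` (`b = false`) or
`B` (`b = true`), in type `B` starting at the bond of label `4`.  This is the opposite of the
numbering of `CoxeterMatrix.B`. -/
def CoxeterMatrix.IsLinearNumbering {B : Type*} (M : CoxeterMatrix B) (b : Bool) {n : ℕ}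
    (e : Fin n ≃ B) : Prop :=
  ∀ i j : Fin n, M (e i) (e j) = bondLabel b i j

/-! ### Coordinates and length of the elements of the Coxeter group -/

namespace CoxeterSystem

variable {B W : Type*} [Group W] {M : CoxeterMatrix B} (cs : CoxeterSystem M W)
  {b : Bool} {n : ℕ} (e : Fin n ≃ B)

/-- The simple reflections listed by `e`, extended by `1` to a sequence. -/
def gen (i : ℕ) : W := if h : i < n then cs.simple (e ⟨i, h⟩) else 1

theorem gen_val (i : Fin n) : cs.gen e i = cs.simple (e i) := by simp [gen]

theorem length_gen_le (i : ℕ) : cs.length (cs.gen e i) ≤ 1 := by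
  unfold gen; split <;> simp

theorem length_pathProd_le (j : ℕ) : ∀ k, cs.length (pathProd (cs.gen e) j k) ≤ k
  | 0 => by simp [pathProd]
  | k + 1 => (cs.length_mul_le _ _).trans
      (Nat.add_le_add (length_pathProd_le j k) (cs.length_gen_le e _))

theorem length_latticeProd_le (f : ℕ → ℕ) :
    ∀ N, cs.length (latticeProd (cs.gen e) N f) ≤ ∑ j ∈ Finset.range N, f j
  | 0 => by simp [latticeProd]
  | N + 1 => by
    rw [Finset.sum_range_succ]
    exact (cs.length_mul_le _ _).trans
      (Nat.add_le_add (length_latticeProd_le f N) (cs.length_pathProd_le e _ _))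

variable {e} (hM : M.IsLinearNumbering b e)
include hM

theorem braidRelations_gen : BraidRelations b n (cs.gen e) :=
  braidRelations_of_pow fun i hi j hj => by
    have := cs.simple_mul_simple_pow (e ⟨i, hi⟩) (e ⟨j, hj⟩)
    rw [hM] at this
    simpa [gen, hi, hj] using this

/-- The action of `W` on lattice points. -/
def latticeAction : W →* Function.End (LatticePoint n) :=
  cs.lift ⟨fun i => LatticePoint.act b n (e.symm i), fun i j => by
    have := (LatticePoint.braidRelations_act b n).mul_pow_bondLabel (e.symm i).2 (e.symm j).2
    rwa [← hM, e.apply_symm_apply, e.apply_symm_apply] at this⟩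

/-- The lattice point of `w`.  The inverse makes right multiplication by a generator correspond
to its action on lattice points. -/
def coords (w : W) : LatticePoint n :=
  cs.latticeAction hM w⁻¹ (LatticePoint.ofFun n 0)

theorem coords_one : cs.coords hM 1 = LatticePoint.ofFun n 0 := by
  simp [coords]; rfl

theorem coords_mul_simple (w : W) (i : B) :
    cs.coords hM (w * cs.simple i) = LatticePoint.act b n (e.symm i) (cs.coords hM w) := by
  unfold coords
  rw [mul_inv_rev, map_mul, cs.inv_simple]
  have : cs.latticeAction hM (cs.simple i) = LatticePoint.act b n (e.symm i) :=
    cs.lift_apply_simple _ i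
  rw [this]; rfl

theorem coords_mul_gen (w : W) {i : ℕ} (hi : i < n) :
    cs.coords hM (w * cs.gen e i) = LatticePoint.act b n i (cs.coords hM w) := by
  rw [gen, dif_pos hi, coords_mul_simple, e.symm_apply_apply]

theorem size_coords_le (w : W) : (cs.coords hM w).size ≤ cs.length w := by
  obtain ⟨ω, hω, rfl⟩ := cs.exists_isReduced w
  rw [hω.eq]
  clear hω
  induction ω using List.reverseRecOn with
  | nil => rw [cs.wordProd_nil, coords_one, LatticePoint.size_ofFun]; simp
  | append_singleton ω i ih =>
    rw [cs.wordProd_append, cs.wordProd_singleton, coords_mul_simple, List.length_append]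
    exact (LatticePoint.size_act_le b n _ _).trans (Nat.add_le_add_right ih 1)

theorem coords_mul_pathProd {N : ℕ} (hN : N < n) {w : W} {f : ℕ → ℕ}
    (hw : cs.coords hM w = LatticePoint.ofFun n f) (hf : ∀ j, N ≤ j → f j = 0) :
    ∀ {k : ℕ}, k ≤ pathLength b N → cs.coords hM (w * pathProd (cs.gen e) N k) =
      LatticePoint.ofFun n (Function.update f N k)
  | 0, _ => by
    rw [pathProd, mul_one, hw]
    congr 1
    rw [← hf N le_rfl, Function.update_eq_self]
  | k + 1, hk => by
    have hl : pathLabel N k < n := pathLabel_lt hN hk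
    rw [pathProd, ← mul_assoc, coords_mul_gen _ _ _ hl, coords_mul_pathProd hN hw hf (by omega),
      LatticePoint.act_pathLabel (by omega) (by simp) (fun i hi => ?_) hN, Function.update_idem]
    rw [Function.update_of_ne hi.ne', hf i hi.le]

/-- The product belonging to `f` has the coordinates `f`. -/
theorem coords_latticeProd {f : ℕ → ℕ} (hf : ∀ j, f j ≤ pathLength b j) :
    ∀ {N : ℕ}, N ≤ n → cs.coords hM (latticeProd (cs.gen e) N f) =
      LatticePoint.ofFun n fun j => if j < N then f j else 0
  | 0, _ => by simp [latticeProd, coords_one]; rfl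
  | N + 1, hN => by
    rw [latticeProd, cs.coords_mul_pathProd hM hN (coords_latticeProd hf (by omega))
      (fun j hj => if_neg hj.not_gt) (hf N)]
    congr 1
    funext j
    by_cases hj : j = N
    · subst hj; simp
    · rw [Function.update_of_ne hj]; grind

theorem length_latticeProd {f : ℕ → ℕ} (hf : ∀ j, f j ≤ pathLength b j) {N : ℕ} (hN : N ≤ n) :
    cs.length (latticeProd (cs.gen e) N f) = ∑ j ∈ Finset.range N, f j := by
  refine (cs.length_latticeProd_le e f N).antisymm ?_
  have := cs.size_coords_le hM (latticeProd (cs.gen e) N f)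
  rw [cs.coords_latticeProd hM hf hN, LatticePoint.size_ofFun] at this
  refine le_trans (le_of_eq ?_) this
  rw [← Finset.sum_subset (Finset.range_subset_range.2 hN)]
  · exact Finset.sum_congr rfl fun j hj => by simp [Finset.mem_range.1 hj]
  · intro j _ hj; exact if_neg (by simpa using hj)

theorem latticeProd_injective {f g : ℕ → ℕ} (hf : ∀ j, f j ≤ pathLength b j)
    (hg : ∀ j, g j ≤ pathLength b j) (h : latticeProd (cs.gen e) n f = latticeProd (cs.gen e) n g) :
    ∀ j < n, f j = g j := by
  have h' := congrArg (cs.coords hM) h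
  rw [cs.coords_latticeProd hM hf le_rfl, cs.coords_latticeProd hM hg le_rfl] at h'
  intro j hj
  simpa [hj] using LatticePoint.eq_of_ofFun_eq h' j hj

/-- The parabolic subgroup on the first `N` nodes consists of the products over the first `N`
paths. -/
theorem mem_closure_gen_iff {N : ℕ} (hN : N ≤ n) {w : W} :
    w ∈ Subgroup.closure (cs.gen e '' Set.Iio N) ↔
      ∃ f : ℕ → ℕ, (∀ j, f j ≤ pathLength b j) ∧ latticeProd (cs.gen e) N f = w := by
  have hrel := cs.braidRelations_gen hM
  constructor
  · intro hw
    induction hw using Subgroup.closure_induction_right with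
    | one => exact ⟨0, by simp, latticeProd_zero⟩
    | mul_right x _ y hy ih =>
      obtain ⟨i, hi, rfl⟩ := hy
      obtain ⟨f, hf, rfl⟩ := ih
      obtain ⟨g, hg, h⟩ := hrel.exists_latticeProd_mul hN hi hf
      exact ⟨g, hg, h.symm⟩
    | mul_inv_cancel x _ y hy ih =>
      obtain ⟨i, hi, rfl⟩ := hy
      obtain ⟨f, hf, rfl⟩ := ih
      obtain ⟨g, hg, h⟩ := hrel.exists_latticeProd_mul hN hi hf
      have : i < N := hi
      rw [inv_eq_of_mul_eq_one_left (hrel.sq i (by omega))]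
      exact ⟨g, hg, h.symm⟩
  · rintro ⟨f, hf, rfl⟩
    have hp : ∀ j < N, ∀ k ≤ pathLength b j,
        pathProd (cs.gen e) j k ∈ Subgroup.closure (cs.gen e '' Set.Iio N) := by
      intro j hj k hk
      induction k with
      | zero => exact one_mem _
      | succ k ih =>
        exact mul_mem (ih (by omega)) (Subgroup.subset_closure ⟨_, pathLabel_lt hj hk, rfl⟩)
    have : ∀ m ≤ N, latticeProd (cs.gen e) m f ∈ Subgroup.closure (cs.gen e '' Set.Iio N) := by
      intro m hm
      induction m with
      | zero => exact one_mem _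
      | succ m ih => exact mul_mem (ih (by omega)) (hp m hm _ (hf m))
    exact this N le_rfl

theorem exists_latticeProd_eq (w : W) :
    ∃ f : ℕ → ℕ, (∀ j, f j ≤ pathLength b j) ∧ latticeProd (cs.gen e) n f = w := by
  rw [← cs.mem_closure_gen_iff hM le_rfl]
  have : Set.range cs.simple ⊆ cs.gen e '' Set.Iio n := by
    rintro _ ⟨i, rfl⟩
    exact ⟨e.symm i, (e.symm i).2, by rw [gen_val, e.apply_symm_apply]⟩
  refine Subgroup.closure_mono this ?_
  rw [cs.subgroup_closure_range_simple]; trivial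

end CoxeterSystem

/-! ### Cubulation of the Bruhat graph -/

namespace CoxeterSystem

variable {B W : Type*} [Group W] {M : CoxeterMatrix B} (cs : CoxeterSystem M W)
  {b : Bool} {n : ℕ} {e : Fin n ≃ B} (hM : M.IsLinearNumbering b e)
include hM

theorem bruhatGraph_adj_update {f : ℕ → ℕ} {i : ℕ} (hi : i < n)
    (hf : ∀ j, f j ≤ pathLength b j) (hfi : f i < pathLength b i) :
    cs.bruhatGraph.Adj (latticeProd (cs.gen e) n f)
      (latticeProd (cs.gen e) n (Function.update f i (f i + 1))) := by
  obtain ⟨u, hu⟩ := exists_latticeProd_update_succ (s := cs.gen e) (f := f) hi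
  have hl : pathLabel i (f i) < n := pathLabel_lt hi hfi
  refine ⟨_, ⟨u, e ⟨_, hl⟩, rfl⟩, ?_⟩
  rw [← gen_val, ← hu, cs.length_latticeProd hM hf le_rfl, cs.length_latticeProd hM _ le_rfl]
  · refine ⟨rfl, Finset.sum_lt_sum (fun j _ => ?_) ⟨i, Finset.mem_range.2 hi, by simp⟩⟩
    by_cases hj : j = i
    · subst hj; simp
    · simp [hj]
  · intro j
    by_cases hj : j = i
    · subst hj; simpa using hfi
    · simp [hj, hf]

theorem bruhatLE_latticeProd {f g : ℕ → ℕ} (hg : ∀ j, g j ≤ pathLength b j) (hfg : ∀ j, f j ≤ g j) :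
    cs.BruhatLE (latticeProd (cs.gen e) n f) (latticeProd (cs.gen e) n g) := by
  induction hd : ∑ j ∈ Finset.range n, (g j - f j) generalizing f with
  | zero =>
    rw [latticeProd_congr fun j hj => ?_]
    · exact .refl
    · have := (Finset.sum_eq_zero_iff.1 hd) j (Finset.mem_range.2 hj)
      have := hfg j
      omega
  | succ d ih =>
    obtain ⟨i, hi, hne⟩ := Finset.exists_ne_zero_of_sum_ne_zero (hd.trans_ne d.succ_ne_zero)
    have hi' := Finset.mem_range.1 hi
    have hlt : f i < g i := by omega
    refine .head (cs.bruhatGraph_adj_update hM hi' (fun j => (hfg j).trans (hg j))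
      (hlt.trans_le (hg i))) (ih (fun j => ?_) ?_)
    · by_cases hj : j = i
      · subst hj; simpa using hlt
      · simp [hj, hfg]
    · rw [← Finset.add_sum_erase _ _ hi] at hd ⊢
      rw [Function.update_self, Finset.sum_congr rfl fun j hj => by
        rw [Function.update_of_ne (Finset.ne_of_mem_erase hj)]]
      omega

/-- A longest element `w₀` belongs to the largest vector in the box, so that it is above every
element in Bruhat order. -/
theorem mem_bruhatInterval {w₀ : W} (hw₀ : cs.IsLongest w₀) (w : W) :
    w ∈ cs.bruhatInterval 1 w₀ := by
  obtain ⟨f, hf, rfl⟩ := cs.exists_latticeProd_eq hM w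
  obtain ⟨g, hg, rfl⟩ := cs.exists_latticeProd_eq hM w₀
  refine ⟨?_, ?_⟩
  · rw [← latticeProd_zero (s := cs.gen e) (N := n)]
    exact cs.bruhatLE_latticeProd hM hf fun j => Nat.zero_le _
  · have hmax := hw₀ (latticeProd (cs.gen e) n (pathLength b))
    rw [cs.length_latticeProd hM hg le_rfl, cs.length_latticeProd hM (fun _ => le_rfl) le_rfl]
      at hmax
    have heq := (Finset.sum_eq_sum_iff_of_le fun j _ => hg j).1
      ((Finset.sum_le_sum fun j _ => hg j).antisymm hmax)
    rw [latticeProd_congr fun j hj => heq j (Finset.mem_range.2 hj)]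
    exact cs.bruhatLE_latticeProd hM (fun _ => le_rfl) hf

end CoxeterSystem

/-- The coordinates of a vertex of a cubical lattice as a sequence of natural numbers, extended
by `0`. -/
def CubicalVertex.toFun {n : ℕ} {k : Fin n → ℕ} (u : CubicalVertex k) (j : ℕ) : ℕ :=
  if h : j < n then (u.1 ⟨j, h⟩).toNat else 0

namespace CoxeterSystem

variable {B W : Type*} [Group W] {M : CoxeterMatrix B} (cs : CoxeterSystem M W)
  {b : Bool} {n : ℕ} {e : Fin n ≃ B} (hM : M.IsLinearNumbering b e)

theorem toFun_le_pathLength (u : CubicalVertex fun i : Fin n => pathLength b i) (j : ℕ) :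
    u.toFun j ≤ pathLength b j := by
  unfold CubicalVertex.toFun
  split_ifs with h
  · have := u.2 ⟨j, h⟩
    simp only at this
    omega
  · exact Nat.zero_le _

include hM

theorem exists_equiv_bruhatInterval {w₀ : W} (hw₀ : cs.IsLongest w₀) :
    ∃ Φ : CubicalVertex (fun i : Fin n => pathLength b i) ≃ cs.bruhatInterval 1 w₀,
      ∀ u v, (cubicalLattice _).Adj u v → (cs.bruhatIntervalGraph 1 w₀).Adj (Φ u) (Φ v) := by
  refine ⟨Equiv.ofBijective (fun u => ⟨latticeProd (cs.gen e) n u.toFun,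
    cs.mem_bruhatInterval hM hw₀ _⟩) ⟨fun u v huv => ?_, fun ⟨w, hw⟩ => ?_⟩, fun u v huv => ?_⟩
  · have h := cs.latticeProd_injective hM (toFun_le_pathLength u) (toFun_le_pathLength v)
      (Subtype.ext_iff.1 huv)
    ext i
    have h1 := h i i.2
    simp only [CubicalVertex.toFun, i.2, dif_pos] at h1
    have hu := (u.2 i).1
    have hv := (v.2 i).1
    simp only [Fin.eta] at h1
    omega
  · obtain ⟨f, hf, rfl⟩ := cs.exists_latticeProd_eq hM w
    refine ⟨⟨fun i => f i, fun i => ⟨Int.natCast_nonneg _, Int.ofNat_le.2 (hf i)⟩⟩, Subtype.ext ?_⟩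
    exact latticeProd_congr fun j hj => by simp [CubicalVertex.toFun, hj]
  · obtain ⟨i, hi⟩ := huv
    have hv : v.toFun = Function.update u.toFun i (u.toFun i + 1) := by
      funext j
      unfold CubicalVertex.toFun
      by_cases hj : j < n
      · have h1 := congrFun hi ⟨j, hj⟩
        have h0 := (u.2 ⟨j, hj⟩).1
        by_cases hij : j = i
        · subst hij
          simp only [Pi.sub_apply, Fin.eta, Pi.single_eq_same] at h0 h1
          simp only [Fin.is_lt, dif_pos, Fin.eta, Function.update_self]
          omega
        · have : (⟨j, hj⟩ : Fin n) ≠ i := fun h => hij (by rw [← h])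
          simp [this] at h1
          simp [hij, hj]
          omega
      · have : j ≠ i := by omega
        simp [hj, this]
    change cs.bruhatGraph.Adj (latticeProd (cs.gen e) n u.toFun) (latticeProd (cs.gen e) n v.toFun)
    have hlt := toFun_le_pathLength v i
    rw [hv, Function.update_self] at hlt
    rw [hv]
    exact cs.bruhatGraph_adj_update hM i.2 (toFun_le_pathLength u) hlt

theorem exists_spanning_subgraph {w₀ : W} (hw₀ : cs.IsLongest w₀) :
    ∃ D ≤ cs.bruhatIntervalGraph 1 w₀,
      (cubicalLattice (fun i : Fin n => pathLength b i)).IsIsomorphic D := by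
  obtain ⟨Φ, hΦ⟩ := cs.exists_equiv_bruhatInterval hM hw₀
  refine ⟨⟨fun x y => (cubicalLattice _).Adj (Φ.symm x) (Φ.symm y)⟩, fun x y h => ?_,
    ⟨Φ, by simp⟩⟩
  simpa using hΦ _ _ h

end CoxeterSystem

/-! ### Normal form trees -/

namespace CoxeterSystem

variable {B W : Type*} [Group W] {M : CoxeterMatrix B} (cs : CoxeterSystem M W)
  {b : Bool} {n : ℕ} {e : Fin n ≃ B}

theorem standardParabolic_image (J : Set (Fin n)) (N : ℕ) (hJ : ∀ i, i ∈ J ↔ (i : ℕ) < N)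
    (hN : N ≤ n) :
    cs.standardParabolic (e '' J) = Subgroup.closure (cs.gen e '' Set.Iio N) := by
  unfold standardParabolic
  congr 1
  ext w
  constructor
  · rintro ⟨_, ⟨i, hi, rfl⟩, rfl⟩
    exact ⟨i, (hJ i).1 hi, cs.gen_val e i⟩
  · rintro ⟨i, hi, rfl⟩
    have hi' : i < N := hi
    exact ⟨_, ⟨⟨i, by omega⟩, (hJ _).2 hi, rfl⟩, (cs.gen_val e ⟨i, by omega⟩).symm⟩

variable (hM : M.IsLinearNumbering b e)
include hM

theorem length_pathProd_mul_pathProd {i j k l : ℕ} (hij : i < j) (hj : j < n)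
    (hk : k ≤ pathLength b i) (hl : l ≤ pathLength b j) :
    cs.length (pathProd (cs.gen e) i k * pathProd (cs.gen e) j l) = k + l := by
  rw [← latticeProd_single hij, ← latticeProd_update, cs.length_latticeProd hM _ hj,
    Finset.sum_range_succ, Function.update_self, Finset.sum_congr rfl fun m hm =>
      Function.update_of_ne (Finset.mem_range.1 hm).ne _ _,
    Finset.sum_pi_single', if_pos (Finset.mem_range.2 hij)]
  intro m
  by_cases hmj : m = j
  · subst hmj; simpa using hl
  · by_cases hmi : m = i
    · subst hmi; simpa [hmj] using hk
    · simp [hmj, hmi]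

theorem length_pathProd {j k : ℕ} (hj : j < n) (hk : k ≤ pathLength b j) :
    cs.length (pathProd (cs.gen e) j k) = k := by
  rw [← latticeProd_single (Nat.lt_succ_self j), cs.length_latticeProd hM _ hj,
    Finset.sum_pi_single', if_pos (by simp)]
  intro m
  by_cases hm : m = j
  · subst hm; simpa using hk
  · simp [hm]

/-- The last label is the only right descent of an element of the `j`-th path. -/
theorem eq_pathLabel_of_length_mul_lt {j k : ℕ} (hj : j < n) (hk : k + 1 ≤ pathLength b j)
    {i : Fin n} (h : cs.length (pathProd (cs.gen e) j (k + 1) * cs.gen e i) = k) :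
    (i : ℕ) = pathLabel j k := by
  have one_le : ∀ m, 1 ≤ pathLength b m := fun m => by unfold pathLength; grind
  rcases Nat.lt_or_ge j i with hi | hi
  · rw [← pathProd_one (cs.gen e), cs.length_pathProd_mul_pathProd hM hi i.2 hk (one_le _)] at h
    omega
  · rcases (cs.braidRelations_gen hM).pathProd_mul_cases hj hi hk with
      ⟨hi', hk'⟩ | ⟨k', hk', hi'⟩ | ⟨i', hi', hp⟩
    · have : pathProd (cs.gen e) j (k + 1) * cs.gen e i = pathProd (cs.gen e) j (k + 2) := by
        rw [hi']; rfl
      rw [this, cs.length_pathProd hM hj hk'] at h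
      omega
    · rw [hi']; congr 1; omega
    · rw [hp, ← pathProd_one (cs.gen e), cs.length_pathProd_mul_pathProd hM hi' hj (one_le _) hk]
        at h
      omega

/-- The sequence of labels is the only reduced expression of an element of a path. -/
theorem IsReducedExpression.map_val {j : ℕ} (hj : j < n) {k : ℕ} (hk : k ≤ pathLength b j)
    {ω : List (Fin n)} (hω : cs.IsReducedExpression e (pathProd (cs.gen e) j k) ω) :
    ω.map Fin.val = (List.range k).map (pathLabel j) := by
  induction k generalizing ω with
  | zero =>
    have h := hω.1.eq
    rw [hω.2, cs.length_pathProd hM hj hk] at h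
    simpa using h.symm
  | succ k ih =>
    obtain ⟨h1, h2⟩ := hω
    have h := h1.eq
    rw [h2, cs.length_pathProd hM hj hk, List.length_map] at h
    rcases List.eq_nil_or_concat ω with rfl | ⟨ω, i, rfl⟩
    · simp at h
    rw [List.concat_eq_append] at *
    simp only [List.length_append, List.length_singleton, Nat.add_right_cancel_iff] at h
    rw [List.map_append, List.map_singleton] at h1 h2
    have hr : cs.IsReduced (ω.map e) := by
      have := h1.take (ω.map e).length
      rwa [List.take_left] at this
    rw [cs.wordProd_append, cs.wordProd_singleton, ← gen_val] at h2
    have hsq : cs.gen e i * cs.gen e i = 1 := by rw [gen_val, cs.simple_mul_simple_self]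
    have hprod : cs.wordProd (ω.map e) = pathProd (cs.gen e) j (k + 1) * cs.gen e i := by
      rw [← h2, mul_assoc, hsq, mul_one]
    have hi : (i : ℕ) = pathLabel j k := by
      apply cs.eq_pathLabel_of_length_mul_lt hM hj hk
      rw [← hprod, hr.eq, List.length_map, h]
    have := ih (by omega) (ω := ω) ⟨hr, by rw [hprod, pathProd, ← hi, mul_assoc, hsq, mul_one]⟩
    rw [List.range_succ, List.map_append, List.map_append, this]
    simp [hi]

theorem isNormalForm_pathProd_iff {j : ℕ} (hj : j < n) {k : ℕ} (hk : k ≤ pathLength b j)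
    {ω : List (Fin n)} : cs.IsNormalForm e (pathProd (cs.gen e) j k) ω ↔
      ω.map Fin.val = (List.range k).map (pathLabel j) := by
  refine ⟨fun h => IsReducedExpression.map_val cs hM hj hk h.1, fun h => ?_⟩
  have uniq : ∀ ω', cs.IsReducedExpression e (pathProd (cs.gen e) j k) ω' → ω' = ω := fun ω' hω' =>
    Fin.val_injective.list_map ((IsReducedExpression.map_val cs hM hj hk hω').trans h.symm)
  obtain ⟨ω₀, h₀, h₁⟩ := cs.exists_isReduced (pathProd (cs.gen e) j k)
  have hmap : (ω₀.map e.symm).map e = ω₀ := by simp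
  have hred : cs.IsReducedExpression e (pathProd (cs.gen e) j k) (ω₀.map e.symm) := by
    unfold IsReducedExpression
    rw [hmap]
    exact ⟨h₀, h₁.symm⟩
  rw [uniq _ hred] at hred
  exact ⟨hred, fun ω' hω' => (uniq ω' hω').ge⟩

theorem mem_minCosetReps_iff (j : Fin n) (w : W) :
    w ∈ cs.minCosetReps e j ↔ ∃ k ≤ pathLength b j, pathProd (cs.gen e) j k = w := by
  unfold minCosetReps
  rw [cs.standardParabolic_image (Set.Iic j) (j + 1) (fun i => by
    rw [Set.mem_Iic, Fin.le_def, Nat.lt_succ_iff]) j.2,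
    cs.standardParabolic_image (Set.Iio j) j (fun i => Iff.rfl) j.2.le]
  simp only [cs.mem_closure_gen_iff hM j.2.le, Set.mem_ofPred_eq,
    cs.mem_closure_gen_iff hM (N := j + 1) j.2]
  constructor
  · rintro ⟨⟨f, hf, rfl⟩, hmin⟩
    refine ⟨f j, hf j, ?_⟩
    have hinv : (latticeProd (cs.gen e) j f)⁻¹ ∈ Subgroup.closure (cs.gen e '' Set.Iio (j : ℕ)) :=
      inv_mem ((cs.mem_closure_gen_iff hM j.2.le).2 ⟨f, hf, rfl⟩)
    have h := hmin _ ((cs.mem_closure_gen_iff hM j.2.le).1 hinv)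
    rw [cs.length_latticeProd hM hf j.2, latticeProd, inv_mul_cancel_left,
      cs.length_pathProd hM j.2 (hf j), Finset.sum_range_succ] at h
    have h0 : ∑ i ∈ Finset.range j, f i = 0 := by omega
    rw [latticeProd, latticeProd_congr (g := 0), latticeProd_zero, one_mul]
    exact fun i hi => Finset.sum_eq_zero_iff.1 h0 i (Finset.mem_range.2 hi)
  · rintro ⟨k, hk, rfl⟩
    refine ⟨⟨Pi.single (j : ℕ) k, fun m => ?_, latticeProd_single (Nat.lt_succ_self _)⟩, ?_⟩
    · by_cases hm : m = j
      · subst hm; simpa using hk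
      · simp [hm]
    · rintro _ ⟨f, hf, rfl⟩
      rw [← latticeProd_update, cs.length_latticeProd hM _ j.2, cs.length_pathProd hM j.2 hk,
        Finset.sum_range_succ, Function.update_self]
      · omega
      · intro m
        by_cases hm : m = j
        · subst hm; simpa using hk
        · simp [hm, hf]

theorem directedPath_isIsomorphic_normalFormTree (j : Fin n) :
    (Digraph.directedPath (pathLength b j)).IsIsomorphic (cs.normalFormTree e j) := by
  have hlt : ∀ k : Fin (pathLength b j + 1), (k : ℕ) ≤ pathLength b j := fun k => by omega
  refine ⟨⟨Equiv.ofBijective (fun k => ⟨pathProd (cs.gen e) j k,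
    (cs.mem_minCosetReps_iff hM j _).2 ⟨k, hlt k, rfl⟩⟩) ⟨fun k l hkl => ?_, fun ⟨w, hw⟩ => ?_⟩,
    fun {k l} => ?_⟩⟩
  · have := congrArg cs.length (Subtype.ext_iff.1 hkl)
    simp only [cs.length_pathProd hM j.2 (hlt _)] at this
    exact Fin.ext this
  · obtain ⟨k, hk, rfl⟩ := (cs.mem_minCosetReps_iff hM j w).1 hw
    exact ⟨⟨k, by omega⟩, rfl⟩
  · change (∃ ω i, cs.IsNormalForm e (pathProd (cs.gen e) j k) ω ∧
      cs.IsNormalForm e (pathProd (cs.gen e) j l) (ω ++ [i])) ↔ (k : ℕ) + 1 = l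
    simp only [cs.isNormalForm_pathProd_iff hM j.2 (hlt _)]
    constructor
    · rintro ⟨ω, i, h1, h2⟩
      have h1 := congrArg List.length h1
      have h2 := congrArg List.length h2
      simp at h1 h2
      omega
    · intro hkl
      have hk : (k : ℕ) < pathLength b j := by have := hlt l; omega
      have hω : ∀ m ≤ pathLength b j,
          ∃ ω : List (Fin n), ω.map Fin.val = (List.range m).map (pathLabel j) := fun m hm =>
        ⟨((List.range m).map (pathLabel j)).pmap Fin.mk fun x hx => by
          obtain ⟨l, hl, rfl⟩ := List.mem_map.1 hx
          exact pathLabel_lt j.2 ((List.mem_range.1 hl).trans_le hm),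
        by simp [List.map_pmap]⟩
      obtain ⟨ω, hω⟩ := hω k (hlt k)
      refine ⟨ω, ⟨pathLabel j k, pathLabel_lt j.2 hk⟩, hω, ?_⟩
      rw [List.map_append, hω, ← hkl, List.range_succ, List.map_append]
      rfl

end CoxeterSystem

/-! ### Types A and B -/

theorem CoxeterMatrix.IsOfTypeA.exists_isLinearNumbering {B : Type*} {M : CoxeterMatrix B} {n : ℕ}
    (h : M.IsOfTypeA n) : ∃ e : Fin n ≃ B, M.IsLinearNumbering false e := by
  obtain ⟨e, he⟩ := h
  refine ⟨e.symm, fun i j => ?_⟩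
  rw [← CoxeterMatrix.reindex_apply, he]
  change (if i = j then 1 else (if (j : ℕ) + 1 = i ∨ (i : ℕ) + 1 = j then 3 else 2)) = _
  simp only [bondLabel, Fin.ext_iff]
  grind

/-- In `CoxeterMatrix.B` the bond of label `4` is at the end of the diagram, so the numbering has to
be reversed. -/
theorem CoxeterMatrix.IsOfTypeB.exists_isLinearNumbering {B : Type*} {M : CoxeterMatrix B} {n : ℕ}
    (hn : 2 ≤ n) (h : M.IsOfTypeB n) : ∃ e : Fin n ≃ B, M.IsLinearNumbering true e := by
  obtain ⟨e, he⟩ := h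
  refine ⟨Fin.revPerm.trans e.symm, fun i j => ?_⟩
  rw [Equiv.trans_apply, Equiv.trans_apply, ← CoxeterMatrix.reindex_apply, he]
  change (if i.rev = j.rev then 1 else
    (if (i.rev : ℕ) = n - 1 ∧ (j.rev : ℕ) = n - 2 ∨ (j.rev : ℕ) = n - 1 ∧ (i.rev : ℕ) = n - 2 then 4
      else (if (j.rev : ℕ) + 1 = i.rev ∨ (i.rev : ℕ) + 1 = j.rev then 3 else 2))) = _
  have := i.2
  have := j.2
  simp only [bondLabel, Fin.ext_iff, Fin.val_rev]
  grind

theorem CoxeterSystem.cubulation_and_paths {B W : Type*} [Group W] {M : CoxeterMatrix B}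
    (cs : CoxeterSystem M W) {w₀ : W} (hw₀ : cs.IsLongest w₀) {b : Bool} {n : ℕ} (hn : 1 ≤ n)
    {e : Fin n ≃ B} (hM : M.IsLinearNumbering b e) :
    (cs.bruhatIntervalGraph 1 w₀).CanBeCubulated ∧
      (cs.bruhatIntervalGraph 1 w₀).IsCubulatedBy
        (cubicalLattice (fun i : Fin n => pathLength b i)) ∧
      ∃ e : Fin n ≃ B, ∀ j : Fin n,
        (Digraph.directedPath (pathLength b j)).IsIsomorphic (cs.normalFormTree e j) := by
  obtain ⟨D, hD, hiso⟩ := cs.exists_spanning_subgraph hM hw₀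
  exact ⟨⟨D, hD, n, hn, _, hiso⟩, ⟨D, hD, hiso⟩, e,
    cs.directedPath_isIsomorphic_normalFormTree hM⟩

theorem theorem2 {B W : Type*} [Group W] [Finite W] {M : CoxeterMatrix B}
    (cs : CoxeterSystem M W) (w₀ : W) (hw₀ : cs.IsLongest w₀) (n : ℕ) :
    (1 ≤ n → M.IsOfTypeA n →
      (cs.bruhatIntervalGraph 1 w₀).CanBeCubulated ∧
      (cs.bruhatIntervalGraph 1 w₀).IsCubulatedBy
        (cubicalLattice (fun i : Fin n => (i : ℕ) + 1)) ∧
      ∃ e : Fin n ≃ B, ∀ j : Fin n,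
        (Digraph.directedPath ((j : ℕ) + 1)).IsIsomorphic (cs.normalFormTree e j)) ∧
    (2 ≤ n → M.IsOfTypeB n →
      (cs.bruhatIntervalGraph 1 w₀).CanBeCubulated ∧
      (cs.bruhatIntervalGraph 1 w₀).IsCubulatedBy
        (cubicalLattice (fun i : Fin n => 2 * (i : ℕ) + 1)) ∧
      ∃ e : Fin n ≃ B, ∀ j : Fin n,
        (Digraph.directedPath (2 * (j : ℕ) + 1)).IsIsomorphic (cs.normalFormTree e j)) := by
  refine ⟨fun hn hA => ?_, fun hn hB => ?_⟩
  · obtain ⟨e, he⟩ := hA.exists_isLinearNumbering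
    exact cs.cubulation_and_paths hw₀ hn he
  · obtain ⟨e, he⟩ := hB.exists_isLinearNumbering hn
    exact cs.cubulation_and_paths hw₀ (by omega) he
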